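/- Let $n,d,M$ be positive integers: the input length, the head dimension and the cache size. For $A_1,A_2,A_3,\mathrm{d}O\in\mathbb R^{n\times d}$ and $X,Y\in\mathbb R^{d\times d}$ put $A=\exp(A_1XA_2^\top)$ (entrywise), $l=A\mathbf 1_n$, $f=\mathrm{diag}(l)^{-1}A$, $O=fA_3Y$, $q=\mathrm{d}O\,(A_3Y)^\top$, and let $p\in\mathbb R^{n\times n}$ have $i$-th row $(\mathrm{diag}(f_i)-f_if_i^\top)q_i$, where $f_i,q_i$ are the $i$-th rows of $f,q$ (as column vectors). The attention gradient is $g=A_1^\top pA_2\in\mathbb R^{d\times d}$. The computational graph of an algorithm is a finite directed acyclic graph whose nodes carry values; the value of a node that has parents is determined by the values of its parents by a fixed operation. It computes the attention gradient using standard matrix multiplication if: its input nodes (no parents) hold entries of $A_1,A_2,A_3,\mathrm{d}O,X,Y$, entries of the forward quantities $l,O$, or constants, with every entry of $A_1,A_2,X$ held by an input node; every entry of $g$ is held, for all data, by an output node (no children); and $A_1XA_2^\top$ is computed from these input nodes either as $(A_1X)A_2^\top$ or as $A_1(XA_2^\top)$ by two standard matrix multiplications, meaning that each entry $(PQ)_{i,j}$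 of a product is the root of a summation tree (of arbitrary shape) whose leaves are the product nodes $P_{i,k}Q_{k,j}$, the trees of different entries of the same product being disjoint. In the red-blue pebble game on such a graph $G$, at first exactly the input nodes carry (blue) pebbles. The operations are: input (put a red pebble on a node carrying a blue one), output (put a blue pebble on a node carrying a red one), compute (put a red pebble on a non-input node all of whose parents carry red pebbles), delete (remove a pebble). In an input or output operation the old pebble is replaced (or, in the variant of the game, kept). At most $M$ red pebbles may be on the graph at any time. The I/O complexity $Q(G,M)$ is the minimum number of input and output operations needed to place blue pebbles on all output nodes ($\infty$ if this is impossible). **Theorem.** If $M=\Omega(d^2)$, then the I/O complexity of attention gradient computation using standard matrix multiplication is $\Omega\left(\frac{n^2d^2+nd^3}{M}\right)$. That is, for every $\kappa>0$ there is a constant $C>0$, depending only on $\kappa$, such that for all positive integers $n,d,M$ with $M\ge\kappa d^2$, for the computational graph $G$ of every algorithm that computes the attention gradient using standard matrix multiplication, and in both variants of the game, $$Q(G,M)\ \ge\ C\cdot\frac{n^2d^2+nd^3}{M}.$$ -/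

import Mathlib

open scoped Matrix ENNReal

/-! ### Directed acyclic graphs and the red-blue pebble game

An edge `G.Adj u v` means that `u` is a parent of `v` (the value of `u` is used to compute `v`). -/

namespace PebbleGame

variable {V : Type*}

/-- A directed graph without directed cycles. -/
def IsDAG (G : Digraph V) : Prop := ∀ v, ¬ Relation.TransGen G.Adj v v

/-- Input nodes: nodes with no parents. -/
def IsInput (G : Digraph V) (v : V) : Prop := ∀ u, ¬ G.Adj u v

/-- Output nodes: nodes with no children. -/
def IsOutput (G : Digraph V) (v : V) : Prop := ∀ w, ¬ G.Adj v w

/-- A position of the game: the nodes that carry a red pebble (a copy of the value in cache) and the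
nodes that carry a blue pebble (a copy of the value in memory). -/
structure Position (V : Type*) where
  red : Set V
  blue : Set V

/-- What happens to the old pebble when a value is moved between memory and cache.
`replace`: it is replaced by the new one. `copy`: it stays on the node, next to the new one. -/
inductive TransferRule where
  | replace
  | copy

/-- What is left of the set `S` of pebbles of the old colour after a transfer at `v`. -/
def TransferRule.leave (r : TransferRule) (S : Set V) (v : V) : Set V :=
  match r with
  | .replace => S \ {v}
  | .copy => S

/-- The two operations that are counted: input (blue to red) and output (red to blue). -/
inductive TransferStep (r : TransferRule) : Position V → Position V → Prop where
  | input (s : Position V) (v : V) (hv : v ∈ s.blue) :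
      TransferStep r s ⟨insert v s.red, r.leave s.blue v⟩
  | output (s : Position V) (v : V) (hv : v ∈ s.red) :
      TransferStep r s ⟨r.leave s.red v, insert v s.blue⟩

/-- The operations that are free: computing a (non-input) node all of whose parents carry red
pebbles, and deleting a pebble. -/
inductive FreeStep (G : Digraph V) : Position V → Position V → Prop where
  | compute (s : Position V) (v : V) (hv : ¬ IsInput G v) (hp : ∀ u, G.Adj u v → u ∈ s.red) :
      FreeStep G s ⟨insert v s.red, s.blue⟩
  | deleteRed (s : Position V) (v : V) (hv : v ∈ s.red) : FreeStep G s ⟨s.red \ {v}, s.blue⟩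
  | deleteBlue (s : Position V) (v : V) (hv : v ∈ s.blue) : FreeStep G s ⟨s.red, s.blue \ {v}⟩

/-- The initial position: blue pebbles on exactly the input nodes, and no red pebble. -/
def start (G : Digraph V) : Position V := ⟨∅, {v | IsInput G v}⟩

/-- `Reaches r G M q s`: the position `s` can be reached from the initial one with exactly `q` input
and output operations and with never more than `M` red pebbles on the graph. -/
inductive Reaches (r : TransferRule) (G : Digraph V) (M : ℕ) : ℕ → Position V → Prop where
  | start : Reaches r G M 0 (start G)
  | transfer {q : ℕ} {s t : Position V} (h : Reaches r G M q s) (hst : TransferStep r s t)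
      (ht : t.red.encard ≤ M) : Reaches r G M (q + 1) t
  | free {q : ℕ} {s t : Position V} (h : Reaches r G M q s) (hst : FreeStep G s t)
      (ht : t.red.encard ≤ M) : Reaches r G M q t

/-- The I/O complexity `Q(G, M)`: the minimum number of input and output operations with which blue
pebbles can be placed on all output nodes using at most `M` red pebbles at any time
(`⊤` if this is impossible with `M` red pebbles). -/
noncomputable def ioComplexity (r : TransferRule) (G : Digraph V) (M : ℕ) : ℕ∞ :=
  ⨅ q ∈ {q : ℕ | ∃ s : Position V, Reaches r G M q s ∧ ∀ v, IsOutput G v → v ∈ s.blue}, (q : ℕ∞)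

end PebbleGame

/-! ### The attention gradient -/

/-- The data of an attention backward pass with input length `n` and head dimension `d`:
the matrices `A₁, A₂, A₃`, the upstream gradient `dO`, and the weights `X`, `Y`. -/
structure AttnData (n d : ℕ) where
  A₁ : Matrix (Fin n) (Fin d) ℝ
  A₂ : Matrix (Fin n) (Fin d) ℝ
  A₃ : Matrix (Fin n) (Fin d) ℝ
  dO : Matrix (Fin n) (Fin d) ℝ
  X : Matrix (Fin d) (Fin d) ℝ
  Y : Matrix (Fin d) (Fin d) ℝ

namespace AttnData

variable {n d : ℕ} (w : AttnData n d)

/-- `A(X) = exp(A₁ X A₂ᵀ)`, entrywise exponential. -/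
noncomputable def expScore : Matrix (Fin n) (Fin n) ℝ := (w.A₁ * w.X * w.A₂ᵀ).map Real.exp

/-- The softmax normalizing vector `l(X) = A(X) 1`. -/
noncomputable def normalizer : Fin n → ℝ := w.expScore *ᵥ 1

/-- The attention matrix `f(X) = diag(l(X))⁻¹ A(X)`. -/
noncomputable def attnMatrix : Matrix (Fin n) (Fin n) ℝ :=
  Matrix.of fun i j => (w.normalizer i)⁻¹ * w.expScore i j

/-- `h(Y) = A₃ Y`. -/
def value : Matrix (Fin n) (Fin d) ℝ := w.A₃ * w.Y

/-- The output `O = f(X) h(Y)` of the forward pass. -/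
noncomputable def forwardOutput : Matrix (Fin n) (Fin d) ℝ := w.attnMatrix * w.value

/-- `q(Y) = dO h(Y)ᵀ`. -/
def upstream : Matrix (Fin n) (Fin n) ℝ := w.dO * w.valueᵀ

/-- `p(X)`, whose `i`-th row is `(diag(f_i) - f_i f_iᵀ) q_i`, where `f_i` and `q_i` are the `i`-th
rows of `f(X)` and `q(Y)`. -/
noncomputable def gradComponent : Matrix (Fin n) (Fin n) ℝ :=
  Matrix.of fun i =>
    (Matrix.diagonal (w.attnMatrix i) - Matrix.vecMulVec (w.attnMatrix i) (w.attnMatrix i)) *ᵥ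
      w.upstream i

/-- The attention gradient `dL(X)/dX = A₁ᵀ p(X) A₂`. -/
noncomputable def gradient : Matrix (Fin d) (Fin d) ℝ := w.A₁ᵀ * w.gradComponent * w.A₂

end AttnData

/-! ### Computational graphs -/

open PebbleGame

/-- The computational graph of an algorithm on data of type `Ω`: a directed acyclic graph each of
whose nodes `v` carries a real number `val v ω` depending on the data `ω`; the value of a node that
is not an input node is obtained by some fixed operation from the values of its parents. -/
structure CompGraph (Ω : Type*) (V : Type*) where
  graph : Digraph V
  isDAG : IsDAG graph
  val : V → Ω → ℝ
  val_local : ∀ v, ¬ IsInput graph v →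
    ∃ op : ({u : V // graph.Adj u v} → ℝ) → ℝ, ∀ ω, val v ω = op fun u => val u.1 ω

namespace CompGraph

variable {Ω V : Type*}

/-- The set `T` of nodes is a summation tree (of any shape) of the graph, with leaves `leaf k`,
`k < b`, and root `root`: every node of `T` that is not a leaf has parents, all of them lie in `T`,
and it carries their sum; the leaves have no parents in `T`; every node of `T` except for the root
has exactly one child in `T`, and the root has none. -/
structure IsSumTree [Finite V] (G : CompGraph Ω V) {b : ℕ} (leaf : Fin b → V) (T : Set V)
    (root : V) : Prop where
  leaf_injective : Function.Injective leaf
  leaf_mem : ∀ k, leaf k ∈ T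
  root_mem : root ∈ T
  leaf_parents : ∀ k, ∀ u ∈ T, ¬ G.graph.Adj u (leaf k)
  exists_parent : ∀ v ∈ T, v ∉ Set.range leaf → ∃ u, G.graph.Adj u v
  parents_mem : ∀ v ∈ T, v ∉ Set.range leaf → ∀ u, G.graph.Adj u v → u ∈ T
  val_eq_sum : ∀ v ∈ T, v ∉ Set.range leaf →
    ∀ ω, G.val v ω = ∑ᶠ u ∈ {u | G.graph.Adj u v}, G.val u ω
  child_unique : ∀ v ∈ T, v ≠ root → ∃! c, c ∈ T ∧ G.graph.Adj v c
  root_child : ∀ c ∈ T, ¬ G.graph.Adj root c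

/-- The graph computes the product of an `a × b` matrix, whose entries are at the nodes `P i k`, and
a `b × c` matrix, whose entries are at the nodes `Q k j`, by standard matrix multiplication, with
the entries of the result at the nodes `R i j`: for all `i, k, j` there is a product node with
parents `P i k` and `Q k j`, and for all `i, j` there is a summation tree from the product nodes
`(i, k, j)`, `k < b`, to `R i j`; different entries of the result have disjoint trees. -/
def IsStdMatMul [Finite V] (G : CompGraph Ω V) {a b c : ℕ} (P : Fin a → Fin b → V)
    (Q : Fin b → Fin c → V) (R : Fin a → Fin c → V) : Prop :=
  ∃ (prod : Fin a → Fin b → Fin c → V) (T : Fin a → Fin c → Set V),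
    (∀ i k j u, G.graph.Adj u (prod i k j) ↔ u = P i k ∨ u = Q k j) ∧
    (∀ i k j ω, G.val (prod i k j) ω = G.val (P i k) ω * G.val (Q k j) ω) ∧
    (∀ i j, G.IsSumTree (fun k => prod i k j) (T i j) (R i j)) ∧
    (∀ i j i' j', (i, j) ≠ (i', j') → Disjoint (T i j) (T i' j'))

/-- What an input node may hold: an entry of the data, an entry of `l(X)` or `O` from the forward
pass, or a constant. -/
inductive IsInputValue {n d : ℕ} : (AttnData n d → ℝ) → Prop where
  | A₁ (i : Fin n) (k : Fin d) : IsInputValue fun w => w.A₁ i k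
  | A₂ (i : Fin n) (k : Fin d) : IsInputValue fun w => w.A₂ i k
  | A₃ (i : Fin n) (k : Fin d) : IsInputValue fun w => w.A₃ i k
  | dO (i : Fin n) (k : Fin d) : IsInputValue fun w => w.dO i k
  | X (k j : Fin d) : IsInputValue fun w => w.X k j
  | Y (k j : Fin d) : IsInputValue fun w => w.Y k j
  | normalizer (i : Fin n) : IsInputValue fun w => w.normalizer i
  | forwardOutput (i : Fin n) (k : Fin d) : IsInputValue fun w => w.forwardOutput i k
  | const (r : ℝ) : IsInputValue fun _ => r

/-- The graph is the computational graph of an algorithm that computes the attention gradient using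
standard matrix multiplication.

The input nodes hold input values, among them the entries of `A₁`, `A₂`, `X`; every entry of the
gradient `A₁ᵀ p(X) A₂` is held, for all data, by an output node; and the matrix `A₁ X A₂ᵀ` is
computed by two standard matrix multiplications, either as `(A₁ X) A₂ᵀ` or as `A₁ (X A₂ᵀ)`.
Nothing is asked of the way in which the gradient is obtained from `A₁ X A₂ᵀ` and the input, so
that algorithms which perform the other products in the standard way are included. -/
structure ComputesAttnGradient [Finite V] {n d : ℕ} (G : CompGraph (AttnData n d) V) : Prop where
  input_val : ∀ v, IsInput G.graph v → IsInputValue (G.val v)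
  gradient_val : ∀ a b, ∃ v, IsOutput G.graph v ∧ ∀ w, G.val v w = w.gradient a b
  std_matMul : ∃ (a₁ a₂ : Fin n → Fin d → V) (x : Fin d → Fin d → V),
    (∀ i k, IsInput G.graph (a₁ i k) ∧ ∀ w, G.val (a₁ i k) w = w.A₁ i k) ∧
    (∀ i k, IsInput G.graph (a₂ i k) ∧ ∀ w, G.val (a₂ i k) w = w.A₂ i k) ∧
    (∀ k j, IsInput G.graph (x k j) ∧ ∀ w, G.val (x k j) w = w.X k j) ∧
    ((∃ (u : Fin n → Fin d → V) (s : Fin n → Fin n → V),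
        G.IsStdMatMul a₁ x u ∧ G.IsStdMatMul u (fun k j => a₂ j k) s) ∨
      (∃ (u : Fin d → Fin n → V) (s : Fin n → Fin n → V),
        G.IsStdMatMul x (fun k j => a₂ j k) u ∧ G.IsStdMatMul a₁ u s))

end CompGraph

/-! ### Moves of the game and phases of a play -/

namespace PebbleGame

variable {V : Type*}

/-! This is a phase argument in the style of Hong and Kung. Cut a play into phases of `M` transfers.
Whatever is red during a phase is computed from a set `D` of at most `2 * M` nodes: those red at its
start and those transferred in it. The scores form a standard product `P * Q` with inner dimension
`d`. A score can appear only if `D` meets its summation tree, which happens for at most `2 * M`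
scores because the trees are disjoint, or if its whole row of `P` and column of `Q` appear. Distinct
entries of `P` cost distinct elements of `D`, even if they are recomputable intermediates
(`HasDisjointCuts`), and likewise for `Q`; so at most `2M/d` full rows and columns appear, and a
phase meets at most `2M + (2M/d)^2` scores (`IsStdMatMul.ncard_roots_le`).

In a finite acyclic graph every node leads to an output node, so a complete play meets all `n^2`
scores and needs many phases. It also reads all of `A₁`, so `n * d ≤ q`; this settles plays with
less than one phase and, by `d^2 ≤ M/κ`, the term `n * d^3`. -/

theorem TransferStep.exists_moved {r : TransferRule} {s t : Position V}
    (h : TransferStep r s t) :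
    ∃ v ∈ s.red ∪ s.blue, t.red ⊆ insert v s.red ∧ t.blue ⊆ insert v s.blue := by
  have hl : ∀ (S : Set V) (v : V), r.leave S v ⊆ S := by
    intro S v
    cases r
    · exact Set.sdiff_subset
    · exact subset_rfl
  cases h with
  | input v hv => exact ⟨v, Or.inr hv, subset_rfl, (hl _ _).trans (Set.subset_insert _ _)⟩
  | output v hv => exact ⟨v, Or.inl hv, (hl _ _).trans (Set.subset_insert _ _), subset_rfl⟩

theorem FreeStep.subset_or_compute {G : Digraph V} {s t : Position V} (h : FreeStep G s t) :
    (t.red ⊆ s.red ∧ t.blue ⊆ s.blue) ∨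
      ∃ v, ¬ IsInput G v ∧ (∀ u, G.Adj u v → u ∈ s.red) ∧ t.red = insert v s.red ∧
        t.blue = s.blue := by
  cases h with
  | compute v hv hp => exact Or.inr ⟨v, hv, hp, rfl, rfl⟩
  | deleteRed v hv => exact Or.inl ⟨Set.sdiff_subset, subset_rfl⟩
  | deleteBlue v hv => exact Or.inl ⟨subset_rfl, Set.sdiff_subset⟩

/-- The nodes of `W` can be computed from those of `D` without leaving `W`. -/
structure Dominates (G : Digraph V) (D W : Set V) : Prop where
  not_isInput : ∀ v ∈ W, v ∉ D → ¬ IsInput G v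
  parents_mem : ∀ v ∈ W, v ∉ D → ∀ u, G.Adj u v → u ∈ W

theorem Dominates.refl (G : Digraph V) (D : Set V) : Dominates G D D :=
  ⟨fun _ h h' => absurd h h', fun _ h h' => absurd h h'⟩

theorem Dominates.insert_both {G : Digraph V} {D W : Set V} (h : Dominates G D W) (v : V) :
    Dominates G (insert v D) (insert v W) := by
  constructor
  · rintro w (rfl | hw) hD
    · exact absurd (Set.mem_insert _ _) hD
    · exact h.not_isInput w hw fun h' => hD (Or.inr h')
  · rintro w (rfl | hw) hD u hu
    · exact absurd (Set.mem_insert _ _) hD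
    · exact Or.inr (h.parents_mem w hw (fun h' => hD (Or.inr h')) u hu)

theorem Dominates.insert_computed {G : Digraph V} {D W : Set V} (h : Dominates G D W) {v : V}
    (hv : ¬ IsInput G v) (hp : ∀ u, G.Adj u v → u ∈ W) : Dominates G D (insert v W) := by
  constructor
  · rintro w (rfl | hw) hD
    · exact hv
    · exact h.not_isInput w hw hD
  · rintro w (rfl | hw) hD u hu
    · exact Or.inr (hp u hu)
    · exact Or.inr (h.parents_mem w hw hD u hu)

/-- Any play splits into `H` complete phases of `M` transfers each, in which the nodes `E` carried
red pebbles, and a current phase, in which the nodes `W` did; if a phase can meet `R` in at most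
`B / e` nodes, then the complete phases have met it in at most `H * B / e`. -/
theorem Reaches.exists_phases [Finite V] {r : TransferRule} {G : Digraph V} {M q : ℕ}
    {s : Position V} (hM : 0 < M) {R : Set V} {e B : ℕ}
    (hB : ∀ D W : Set V, Dominates G D W → D.ncard ≤ 2 * M → (R ∩ W).ncard * e ≤ B)
    (h : Reaches r G M q s) :
    ∃ (H c : ℕ) (E D W : Set V), q = H * M + c ∧ c ≤ M ∧ D.ncard ≤ M + c ∧ Dominates G D W ∧
      (R ∩ E).ncard * e ≤ H * B ∧ s.red ⊆ W ∧ (∀ v ∈ s.blue, IsInput G v ∨ v ∈ E ∪ W) ∧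
      (∀ v ∈ E ∪ W, ¬ IsInput G v → ∀ u, G.Adj u v → u ∈ E ∪ W) ∧
      ((E ∪ W) ∩ {v | IsInput G v}).ncard ≤ q := by
  induction h with
  | start =>
    exact ⟨0, 0, ∅, ∅, ∅, by simp, by simp, by simp, .refl _ _, by simp, Set.empty_subset _,
      fun v hv => Or.inl hv, by simp, by simp⟩
  | @transfer q s t h hst ht ih =>
    obtain ⟨H, c, E, D, W, hq, hc, hD, hdom, hE, hred, hblue, hpar, hin⟩ := ih
    obtain ⟨v, hv, hr, hb⟩ := hst.exists_moved
    -- A moved node that is not an input was visited before, so its parents are already in `E ∪ W`;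
    -- only inputs can be new.
    have hv' : IsInput G v ∨ v ∈ E ∪ W := hv.elim (fun h => .inr (.inr (hred h))) (hblue v)
    have hblue' : ∀ w ∈ t.blue, IsInput G w ∨ w ∈ insert v (E ∪ W) := by
      intro w hw
      rcases hb hw with rfl | hw
      · exact Or.inr (Set.mem_insert _ _)
      · exact (hblue w hw).imp_right Or.inr
    have hpar' : ∀ w ∈ insert v (E ∪ W), ¬ IsInput G w → ∀ u, G.Adj u w →
        u ∈ insert v (E ∪ W) := by
      rintro w (rfl | hw) hwi u hu
      · exact Or.inr (hpar w (hv'.resolve_left hwi) hwi u hu)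
      · exact Or.inr (hpar w hw hwi u hu)
    have hin' : (insert v (E ∪ W) ∩ {v | IsInput G v}).ncard ≤ q + 1 := by
      calc (insert v (E ∪ W) ∩ {v | IsInput G v}).ncard
          ≤ (insert v ((E ∪ W) ∩ {v | IsInput G v})).ncard :=
            Set.ncard_le_ncard (by
              rintro w ⟨rfl | hw, hw'⟩
              · exact Or.inl rfl
              · exact Or.inr ⟨hw, hw'⟩) (Set.toFinite _)
        _ ≤ _ := (Set.ncard_insert_le _ _).trans (by omega)
    -- A full phase is closed only when the next transfer arrives, so the new one starts with count
    -- 1 and with at most `M` red nodes and `v` in `D`.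
    rcases hc.lt_or_eq with hc | rfl
    · refine ⟨H, c + 1, E, insert v D, insert v W, by omega, hc, ?_, hdom.insert_both v, hE,
        hr.trans (Set.insert_subset_insert hred), ?_⟩
      · exact (Set.ncard_insert_le _ _).trans (by omega)
      · rw [Set.union_insert]
        exact ⟨hblue', hpar', hin'⟩
    · have hU : E ∪ W ∪ insert v t.red = insert v (E ∪ W) := by
        rw [Set.union_insert]
        apply subset_antisymm
        · apply Set.insert_subset (Set.mem_insert _ _)
          apply Set.union_subset (Set.subset_insert _ _)
          exact hr.trans (Set.insert_subset_insert (hred.trans Set.subset_union_right))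
        · exact Set.insert_subset_insert Set.subset_union_left
      refine ⟨H + 1, 1, E ∪ W, insert v t.red, insert v t.red, by rw [hq]; ring, hM, ?_,
        .refl _ _, ?_, Set.subset_insert _ _, ?_⟩
      · refine (Set.ncard_insert_le _ _).trans (Nat.add_le_add_right ?_ 1)
        rw [← Set.Finite.cast_ncard_eq (Set.toFinite _)] at ht
        exact_mod_cast ht
      · rw [Set.inter_union_distrib_left]
        calc _ ≤ ((R ∩ E).ncard + (R ∩ W).ncard) * e :=
              Nat.mul_le_mul_right _ (Set.ncard_union_le _ _)
          _ ≤ (H + 1) * B := by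
              have := hB D W hdom (by omega)
              rw [add_mul, add_mul, one_mul]
              exact add_le_add hE this
      · rw [hU]
        exact ⟨hblue', hpar', hin'⟩
  | @free q s t h hst ht ih =>
    obtain ⟨H, c, E, D, W, hq, hc, hD, hdom, hE, hred, hblue, hpar, hin⟩ := ih
    rcases hst.subset_or_compute with ⟨hr, hb⟩ | ⟨v, hv, hp, hr, hb⟩
    · exact ⟨H, c, E, D, W, hq, hc, hD, hdom, hE, hr.trans hred, fun v hv => hblue v (hb hv),
        hpar, hin⟩
    · refine ⟨H, c, E, D, insert v W, hq, hc, hD,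
        hdom.insert_computed hv fun u hu => hred (hp u hu), hE, ?_, ?_, ?_, ?_⟩
      · rw [hr]
        exact Set.insert_subset_insert hred
      · rw [hb, Set.union_insert]
        exact fun w hw => (hblue w hw).imp_right Or.inr
      · rw [Set.union_insert]
        rintro w (rfl | hw) hwi u hu
        · exact Or.inr (Or.inr (hred (hp u hu)))
        · exact Or.inr (hpar w hw hwi u hu)
      · rw [Set.union_insert, Set.insert_inter_of_notMem hv]
        exact hin

/-! ### Nodes that a complete play must visit -/

theorem IsDAG.wellFounded_child [Finite V] {G : Digraph V} (hG : IsDAG G) :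
    WellFounded fun c v => G.Adj v c := by
  let r : V → V → Prop := fun c v => Relation.TransGen G.Adj v c
  have : IsTrans V r := ⟨fun _ _ _ hab hbc => hbc.trans hab⟩
  have : Std.Irrefl r := ⟨hG⟩
  exact Subrelation.wf (fun h => Relation.TransGen.single h)
    (Finite.wellFounded_of_trans_of_irrefl r)

/-- A set of nodes that contains the parents of its non-input nodes and all output nodes that are
not inputs contains every node that is not isolated. -/
theorem IsDAG.mem_of_parents_mem [Finite V] {G : Digraph V} (hG : IsDAG G) {F : Set V}
    (hpar : ∀ v ∈ F, ¬ IsInput G v → ∀ u, G.Adj u v → u ∈ F)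
    (hout : ∀ v, IsOutput G v → IsInput G v ∨ v ∈ F) (v : V) :
    (IsOutput G v ∧ IsInput G v) ∨ v ∈ F := by
  induction v using hG.wellFounded_child.induction with
  | _ v ih =>
    by_cases hv : IsOutput G v
    · exact (hout v hv).imp_left fun h => ⟨hv, h⟩
    · simp only [IsOutput, not_forall, not_not] at hv
      obtain ⟨c, hc⟩ := hv
      -- The child has a parent, so it is not isolated; it lies in `F` and brings its parents along.
      have hci : ¬ IsInput G c := fun h => h v hc
      exact Or.inr (hpar c ((ih c hc).resolve_left fun h => hci h.2) hci v hc)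

/-! ### Disjoint cuts -/

theorem card_le_ncard_of_disjoint [Finite V] {ι : Type*} {Z : ι → Set V}
    (hZ : Pairwise fun x y => Disjoint (Z x) (Z y)) {D : Set V} {I : Finset ι}
    (hI : ∀ x ∈ I, (D ∩ Z x).Nonempty) : I.card ≤ D.ncard := by
  obtain rfl | ⟨x₀, hx₀⟩ := I.eq_empty_or_nonempty
  · simp
  have : Nonempty V := ⟨(hI x₀ hx₀).some⟩
  choose! f hf using hI
  rw [← Set.ncard_coe_finset]
  refine Set.ncard_le_ncard_of_injOn f (fun x hx => (hf x hx).1) ?_ (Set.toFinite _)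
  intro x hx y hy hxy
  by_contra hne
  exact (hZ hne).le_bot ⟨(hf x hx).2, hxy ▸ (hf y hy).2⟩

/-- There are disjoint sets of nodes, one for each `P x`, such that every set of nodes from which
`P x` can be computed meets the one for `P x`. -/
def HasDisjointCuts (G : Digraph V) {ι : Type*} (P : ι → V) : Prop :=
  ∃ Z : ι → Set V, (Pairwise fun x y => Disjoint (Z x) (Z y)) ∧
    ∀ D W, Dominates G D W → ∀ x, P x ∈ W → (D ∩ Z x).Nonempty

/-- An input cannot be computed, so it is its own cut. -/
theorem hasDisjointCuts_of_isInput {G : Digraph V} {ι : Type*} {P : ι → V}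
    (hP : Function.Injective P) (hin : ∀ x, IsInput G (P x)) : HasDisjointCuts G P := by
  refine ⟨fun x => {P x}, fun x y h => by simpa using hP.ne h, fun D W h x hx => ?_⟩
  refine ⟨P x, ?_, rfl⟩
  by_contra hD
  exact h.not_isInput _ hx hD (hin x)

theorem HasDisjointCuts.card_le [Finite V] {G : Digraph V} {ι : Type*} {P : ι → V}
    (h : HasDisjointCuts G P) {D W : Set V} (hdom : Dominates G D W) {I : Finset ι}
    (hI : ∀ x ∈ I, P x ∈ W) : I.card ≤ D.ncard :=
  let ⟨_, hZ, hcut⟩ := h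
  card_le_ncard_of_disjoint hZ fun x hx => hcut D W hdom x (hI x hx)

end PebbleGame

/-! ### Standard matrix multiplication -/

namespace CompGraph

variable {Ω V : Type*} {G : CompGraph Ω V}

theorem injective_of_val_eq {ι : Type*} {P : ι → V} {f : ι → Ω → ℝ}
    (hval : ∀ x w, G.val (P x) w = f x w) (hf : Function.Injective f) : Function.Injective P :=
  fun x y hxy => hf (funext fun w => by rw [← hval, ← hval, hxy])

variable [Finite V]

/-- Go from the root towards the leaves: the child of a tree node is in `W` and outside `D`, which
forces its parents into `W`. -/
theorem IsSumTree.subset_of_root_mem {b : ℕ} {leaf : Fin b → V} {T : Set V} {root : V}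
    (hT : G.IsSumTree leaf T root) {D W : Set V} (hdom : Dominates G.graph D W)
    (hroot : root ∈ W) (hTD : ¬ (D ∩ T).Nonempty) : T ⊆ W := by
  intro v
  induction v using G.isDAG.wellFounded_child.induction with
  | _ v ih =>
    intro hv
    by_cases hvr : v = root
    · exact hvr ▸ hroot
    · obtain ⟨c, ⟨hcT, hvc⟩, -⟩ := hT.child_unique v hv hvr
      exact hdom.parents_mem c (ih c hvc hcT) (fun hcD => hTD ⟨c, hcD, hcT⟩) v hvc

section StdMatMul

variable {a b c : ℕ} {P : Fin a → Fin b → V} {Q : Fin b → Fin c → V} {R : Fin a → Fin c → V}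

theorem IsStdMatMul.injective (h : G.IsStdMatMul P Q R) :
    Function.Injective fun x : Fin a × Fin c => R x.1 x.2 := by
  obtain ⟨prod, T, -, -, hT, hdisj⟩ := h
  intro x y hxy
  by_contra hne
  exact (hdisj x.1 x.2 y.1 y.2 hne).le_bot
    ⟨(hT _ _).root_mem, (show R x.1 x.2 = R y.1 y.2 from hxy) ▸ (hT y.1 y.2).root_mem⟩

theorem IsStdMatMul.exists_child_left (h : G.IsStdMatMul P Q R) (i : Fin a) (k : Fin b)
    (j : Fin c) : ∃ v, G.graph.Adj (P i k) v := by
  obtain ⟨prod, T, hp, -⟩ := h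
  exact ⟨prod i k j, (hp _ _ _ _).2 (Or.inl rfl)⟩

theorem IsStdMatMul.not_isInput (h : G.IsStdMatMul P Q R) (i : Fin a) (j : Fin c) :
    ¬ IsInput G.graph (R i j) := by
  obtain ⟨prod, T, hp, -, hT, -⟩ := h
  intro hin
  by_cases hl : R i j ∈ Set.range fun k => prod i k j
  · obtain ⟨k, hk⟩ := hl
    exact hin (P i k) (hk ▸ (hp i k j _).2 (Or.inl rfl))
  · obtain ⟨u, hu⟩ := (hT i j).exists_parent _ (hT i j).root_mem hl
    exact hin u hu

/-- If for every entry of the product some input node, not shared with other entries, is an operand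
of one of its product nodes, then the entries have disjoint cuts. -/
theorem IsStdMatMul.hasDisjointCuts (h : G.IsStdMatMul P Q R) {src : Fin a × Fin c → V}
    (hinj : Function.Injective src) (hsrc : ∀ x, IsInput G.graph (src x))
    (hop : ∀ x : Fin a × Fin c, ∃ k, src x = P x.1 k ∨ src x = Q k x.2) :
    HasDisjointCuts G.graph fun x : Fin a × Fin c => R x.1 x.2 := by
  obtain ⟨prod, T, hp, -, hT, hdisj⟩ := h
  have hTin : ∀ i j, ∀ v ∈ T i j, ¬ IsInput G.graph v := by
    intro i j v hv hin
    by_cases hl : v ∈ Set.range fun k => prod i k j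
    · obtain ⟨k, rfl⟩ := hl
      exact hin (P i k) ((hp i k j _).2 (Or.inl rfl))
    · obtain ⟨u, hu⟩ := (hT i j).exists_parent _ hv hl
      exact hin u hu
  -- The cut is the tree together with the assigned input. If `D` misses the tree, all operands are
  -- in `W`, and the input among them must belong to `D`. Trees contain no inputs, so the cuts stay
  -- disjoint.
  refine ⟨fun x => insert (src x) (T x.1 x.2), ?_, ?_⟩
  · intro x y hxy
    rw [Set.disjoint_left]
    rintro v (rfl | hv) (hv' | hv')
    · exact hxy (hinj hv')
    · exact hTin _ _ _ hv' (hsrc x)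
    · exact hTin _ _ _ hv (hv' ▸ hsrc y)
    · exact (hdisj x.1 x.2 y.1 y.2 hxy).le_bot ⟨hv, hv'⟩
  · intro D W hdom x hx
    by_cases hD : (D ∩ T x.1 x.2).Nonempty
    · exact hD.mono (Set.inter_subset_inter_right _ (Set.subset_insert _ _))
    · obtain ⟨k, hk⟩ := hop x
      have hl := (hT x.1 x.2).leaf_mem k
      have hsW : src x ∈ W :=
        hdom.parents_mem _ ((hT x.1 x.2).subset_of_root_mem hdom hx hD hl)
          (fun h => hD ⟨_, h, hl⟩) _ ((hp _ _ _ _).2 hk)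
      refine ⟨src x, ?_, Set.mem_insert _ _⟩
      by_contra hsD
      exact hdom.not_isInput _ hsW hsD (hsrc x)

/-- From `m` values at most `m + (m / b) ^ 2` entries of the product can be computed. -/
theorem IsStdMatMul.ncard_roots_le (h : G.IsStdMatMul P Q R)
    (hP : HasDisjointCuts G.graph fun x : Fin a × Fin b => P x.1 x.2)
    (hQ : HasDisjointCuts G.graph fun x : Fin b × Fin c => Q x.1 x.2) {D W : Set V} {m : ℕ}
    (hdom : Dominates G.graph D W) (hD : D.ncard ≤ m) :
    (Set.range (fun x : Fin a × Fin c => R x.1 x.2) ∩ W).ncard * b ^ 2 ≤ m * b ^ 2 + m ^ 2 := by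
  classical
  obtain ⟨prod, T, hp, -, hT, hdisj⟩ := h
  -- A computed entry lies in `K₁` if `D` hits its tree, and in `I ×ˢ J` otherwise. Each full row or
  -- column uses up `b` elements of `D`.
  let K : Finset (Fin a × Fin c) := {x | R x.1 x.2 ∈ W}
  let K₁ : Finset (Fin a × Fin c) := {x | (D ∩ T x.1 x.2).Nonempty}
  let I : Finset (Fin a) := {i | ∀ k, P i k ∈ W}
  let J : Finset (Fin c) := {j | ∀ k, Q k j ∈ W}
  have hK₁ : K₁.card ≤ m :=
    (card_le_ncard_of_disjoint (Z := fun x : Fin a × Fin c => T x.1 x.2)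
      (fun x y hxy => hdisj x.1 x.2 y.1 y.2 hxy) fun x hx => (Finset.mem_filter.1 hx).2).trans hD
  have hI : I.card * b ≤ m := by
    have : (I ×ˢ (Finset.univ : Finset (Fin b))).card ≤ D.ncard :=
      hP.card_le hdom fun x hx => (Finset.mem_filter.1 (Finset.mem_product.1 hx).1).2 x.2
    rw [Finset.card_product, Finset.card_fin] at this
    exact this.trans hD
  have hJ : J.card * b ≤ m := by
    have : ((Finset.univ : Finset (Fin b)) ×ˢ J).card ≤ D.ncard :=
      hQ.card_le hdom fun x hx => (Finset.mem_filter.1 (Finset.mem_product.1 hx).2).2 x.1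
    rw [Finset.card_product, Finset.card_fin, mul_comm] at this
    exact this.trans hD
  have hK : K ⊆ K₁ ∪ I ×ˢ J := by
    intro x hx
    have hxW : R x.1 x.2 ∈ W := (Finset.mem_filter.1 hx).2
    by_cases hxD : (D ∩ T x.1 x.2).Nonempty
    · exact Finset.mem_union_left _ (Finset.mem_filter.2 ⟨Finset.mem_univ _, hxD⟩)
    · have hpar : ∀ k u, (u = P x.1 k ∨ u = Q k x.2) → u ∈ W := fun k u hu =>
        have hl := (hT x.1 x.2).leaf_mem k
        hdom.parents_mem _ ((hT x.1 x.2).subset_of_root_mem hdom hxW hxD hl)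
          (fun h => hxD ⟨_, h, hl⟩) u ((hp _ _ _ _).2 hu)
      refine Finset.mem_union_right _ (Finset.mem_product.2 ⟨?_, ?_⟩)
      · exact Finset.mem_filter.2 ⟨Finset.mem_univ _, fun k => hpar k _ (Or.inl rfl)⟩
      · exact Finset.mem_filter.2 ⟨Finset.mem_univ _, fun k => hpar k _ (Or.inr rfl)⟩
  have hR : (Set.range (fun x : Fin a × Fin c => R x.1 x.2) ∩ W).ncard ≤ K.card := by
    refine le_trans (Set.ncard_le_ncard ?_ (Set.toFinite _))
      ((Set.ncard_coe_finset _).le.trans (Finset.card_image_le (s := K)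
        (f := fun x : Fin a × Fin c => R x.1 x.2)))
    rintro _ ⟨⟨x, rfl⟩, hx⟩
    exact Finset.mem_coe.2 (Finset.mem_image_of_mem _ (Finset.mem_filter.2 ⟨Finset.mem_univ x, hx⟩))
  have hcard : K.card ≤ K₁.card + I.card * J.card :=
    (Finset.card_le_card hK).trans ((Finset.card_union_le _ _).trans
      (by rw [Finset.card_product]))
  calc _ ≤ (K₁.card + I.card * J.card) * b ^ 2 := Nat.mul_le_mul_right _ (hR.trans hcard)
    _ = K₁.card * b ^ 2 + (I.card * b) * (J.card * b) := by ring
    _ ≤ m * b ^ 2 + m * m := by gcongr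
    _ = m * b ^ 2 + m ^ 2 := by ring

end StdMatMul

/-! ### Graphs computing the attention gradient -/

/-- The scores of an algorithm that computes the attention gradient are the entries of a standard
matrix product of two matrices whose entries have disjoint cuts. -/
theorem ComputesAttnGradient.exists_scores {n d : ℕ} {G : CompGraph (AttnData n d) V}
    (hG : G.ComputesAttnGradient) :
    ∃ (P : Fin n → Fin d → V) (Q : Fin d → Fin n → V) (S : Fin n → Fin n → V),
      G.IsStdMatMul P Q S ∧ (HasDisjointCuts G.graph fun x : Fin n × Fin d => P x.1 x.2) ∧
        HasDisjointCuts G.graph fun x : Fin d × Fin n => Q x.1 x.2 := by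
  obtain ⟨a₁, a₂, x, h₁, h₂, -, hmul⟩ := hG.std_matMul
  have hi₁ : Function.Injective fun x : Fin n × Fin d => a₁ x.1 x.2 :=
    injective_of_val_eq (f := fun x w => w.A₁ x.1 x.2) (fun x w => (h₁ _ _).2 w) fun x y hxy => by
      by_contra hne
      -- Data whose only nonzero entry is a 1 in `A₁` at `x` separates `x` from `y`.
      have := congrFun hxy ⟨fun i k => if (i, k) = x then 1 else 0, 0, 0, 0, 0, 0⟩
      simp [Ne.symm hne] at this
  have hi₂ : Function.Injective fun x : Fin d × Fin n => a₂ x.2 x.1 :=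
    injective_of_val_eq (f := fun x w => w.A₂ x.2 x.1) (fun x w => (h₂ _ _).2 w) fun x y hxy => by
      by_contra hne
      have := congrFun hxy ⟨0, fun i k => if (k, i) = x then 1 else 0, 0, 0, 0, 0⟩
      simp [Ne.symm hne] at this
  have hc₁ := hasDisjointCuts_of_isInput hi₁ fun x => (h₁ x.1 x.2).1
  have hc₂ := hasDisjointCuts_of_isInput hi₂ fun x => (h₂ x.2 x.1).1
  rcases hmul with ⟨u, s, hu, hs⟩ | ⟨u, s, hu, hs⟩
  -- `X` is square, so entry `(i, k)` of `A₁ X` can be assigned the input `(i, k)` of `A₁`, one of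
  -- its operands.
  · exact ⟨_, _, s, hs, hu.hasDisjointCuts hi₁ (fun x => (h₁ x.1 x.2).1)
      fun x => ⟨x.2, Or.inl rfl⟩, hc₂⟩
  · exact ⟨_, _, s, hs, hc₁, hu.hasDisjointCuts hi₂ (fun x => (h₂ x.2 x.1).1)
      fun x => ⟨x.1, Or.inr rfl⟩⟩

/-- The entries of `A₁` are held by different input nodes that are not output nodes. -/
theorem ComputesAttnGradient.exists_inputs {n d : ℕ} {G : CompGraph (AttnData n d) V}
    (hG : G.ComputesAttnGradient) :
    ∃ a : Fin n × Fin d → V, Function.Injective a ∧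
      ∀ x, IsInput G.graph (a x) ∧ ¬ IsOutput G.graph (a x) := by
  obtain ⟨a₁, a₂, x, h₁, h₂, -, hmul⟩ := hG.std_matMul
  refine ⟨fun x => a₁ x.1 x.2, injective_of_val_eq (f := fun x w => w.A₁ x.1 x.2)
    (fun x w => (h₁ _ _).2 w) fun x y hxy => ?_, fun x => ⟨(h₁ _ _).1, fun hout => ?_⟩⟩
  · by_contra hne
    have := congrFun hxy ⟨fun i k => if (i, k) = x then 1 else 0, 0, 0, 0, 0, 0⟩
    simp [Ne.symm hne] at this
  · rcases hmul with ⟨u, s, hu, hs⟩ | ⟨u, s, hu, hs⟩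
    · obtain ⟨v, hv⟩ := hu.exists_child_left x.1 x.2 x.2
      exact hout v hv
    · obtain ⟨v, hv⟩ := hs.exists_child_left x.1 x.2 x.1
      exact hout v hv

/-- Bounds on the number `q` of transfers in a complete play: the entries of `A₁` are all read, and
there are at most `q / M + 1` phases. -/
theorem ComputesAttnGradient.transfer_bounds {n d M q : ℕ} {G : CompGraph (AttnData n d) V}
    (hG : G.ComputesAttnGradient) (hM : 0 < M) {r : TransferRule} {s : Position V}
    (hs : Reaches r G.graph M q s) (hout : ∀ v, IsOutput G.graph v → v ∈ s.blue) :
    n * d ≤ q ∧ ∃ H, H * M ≤ q ∧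
      n ^ 2 * d ^ 2 ≤ (H + 1) * (2 * M * d ^ 2 + (2 * M) ^ 2) := by
  obtain ⟨P, Q, S, hS, hP, hQ⟩ := hG.exists_scores
  obtain ⟨a, ha, hain⟩ := hG.exists_inputs
  set R := Set.range fun x : Fin n × Fin n => S x.1 x.2 with hR
  have hB := fun D W hdom hD => hS.ncard_roots_le hP hQ (D := D) (W := W) (m := 2 * M) hdom hD
  obtain ⟨H, c, E, D, W, hq, hc, hD, hdom, hE, -, hblue, hpar, hin⟩ := hs.exists_phases hM hB
  have hmem := G.isDAG.mem_of_parents_mem hpar fun v hv => hblue v (hout v hv)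
  refine ⟨?_, H, by omega, ?_⟩
  · have hsub : Set.range a ⊆ (E ∪ W) ∩ {v | IsInput G.graph v} := by
      rintro _ ⟨x, rfl⟩
      exact ⟨(hmem _).resolve_left fun h => (hain x).2 h.1, (hain x).1⟩
    have := (Set.ncard_le_ncard hsub (Set.toFinite _)).trans hin
    rwa [← Set.image_univ, Set.ncard_image_of_injective _ ha, Set.ncard_univ, Nat.card_prod,
      Nat.card_fin, Nat.card_fin] at this
  · have hsub : R ⊆ (R ∩ E) ∪ (R ∩ W) := by
      rw [← Set.inter_union_distrib_left]
      rintro v hv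
      refine ⟨hv, (hmem v).resolve_left fun h => ?_⟩
      obtain ⟨x, rfl⟩ := hv
      exact hS.not_isInput _ _ h.2
    have hcard : n ^ 2 ≤ (R ∩ E).ncard + (R ∩ W).ncard := by
      have := (Set.ncard_le_ncard hsub (Set.toFinite _)).trans (Set.ncard_union_le _ _)
      rwa [hR, ← Set.image_univ, Set.ncard_image_of_injective _ hS.injective, Set.ncard_univ,
        Nat.card_prod, Nat.card_fin, ← sq, Set.image_univ] at this
    -- The current phase counts as one more, whence `H + 1`.
    calc n ^ 2 * d ^ 2 ≤ ((R ∩ E).ncard + (R ∩ W).ncard) * d ^ 2 := Nat.mul_le_mul_right _ hcard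
      _ ≤ (H + 1) * (2 * M * d ^ 2 + (2 * M) ^ 2) := by
        rw [add_mul, add_mul, one_mul]
        exact add_le_add hE (hB D W hdom (by omega))

end CompGraph

/-! ### Arithmetic and conclusion -/

theorem io_lower_bound_of_phases {κ n d M q H : ℝ} (hκ : 0 < κ) (hM : 0 < M)
    (hn : 0 ≤ n) (hd : 0 ≤ d) (hq : 0 ≤ q) (hH : 0 ≤ H)
    (hκM : κ * d ^ 2 ≤ M) (hnd : n * d ≤ q) (hHM : H * M ≤ q)
    (hroots : n ^ 2 * d ^ 2 ≤ (H + 1) * (2 * M * d ^ 2 + (2 * M) ^ 2)) :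
    (n ^ 2 * d ^ 2 + n * d ^ 3) / M ≤ (8 + 5 / κ) * q := by
  have hd2 : d ^ 2 ≤ M / κ := by rw [le_div_iff₀ hκ]; linarith
  have hsmall : n * d ^ 3 ≤ M * (q / κ) :=
    calc n * d ^ 3 = (n * d) * d ^ 2 := by ring
      _ ≤ q * (M / κ) := by gcongr
      _ = M * (q / κ) := by ring
  have hlarge : n ^ 2 * d ^ 2 ≤ M * ((8 + 4 / κ) * q) := by
    -- If `M ≤ q`, the extra phase is absorbed by `H * M + M ≤ 2 * q`. Otherwise the phase count
    -- says too little, and squaring `n * d ≤ q` suffices.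
    rcases le_total M q with h | h
    · calc n ^ 2 * d ^ 2 ≤ (H + 1) * (2 * M * d ^ 2 + (2 * M) ^ 2) := hroots
        _ ≤ (H + 1) * (2 * M * (M / κ) + (2 * M) ^ 2) := by gcongr
        _ = M * ((4 + 2 / κ) * (H * M + M)) := by ring
        _ ≤ M * ((4 + 2 / κ) * (q + q)) := by gcongr
        _ = _ := by ring
    · calc n ^ 2 * d ^ 2 = (n * d) * (n * d) := by ring
        _ ≤ q * q := by gcongr
        _ ≤ M * q := by gcongr
        _ = M * (1 * q) := by ring
        _ ≤ M * ((8 + 4 / κ) * q) := by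
          have : 0 ≤ 4 / κ := by positivity
          gcongr
          linarith
  rw [div_le_iff₀ hM]
  calc _ ≤ M * ((8 + 4 / κ) * q) + M * (q / κ) := add_le_add hlarge hsmall
    _ = (8 + 5 / κ) * q * M := by ring

theorem theoremE2 (κ : ℝ) (hκ : 0 < κ) :
    ∃ C : ℝ, 0 < C ∧
      ∀ n d M : ℕ, 0 < n → 0 < d → 0 < M → κ * (d : ℝ) ^ 2 ≤ (M : ℝ) →
        ∀ (V : Type*) [Finite V] (G : CompGraph (AttnData n d) V), G.ComputesAttnGradient →
          ∀ r : PebbleGame.TransferRule,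
            ENNReal.ofReal
                (C * (((n : ℝ) ^ 2 * (d : ℝ) ^ 2 + (n : ℝ) * (d : ℝ) ^ 3) / (M : ℝ))) ≤
              ((PebbleGame.ioComplexity r G.graph M : ℕ∞) : ℝ≥0∞) := by
  have hK : 0 < 8 + 5 / κ := by positivity
  refine ⟨(8 + 5 / κ)⁻¹, inv_pos.2 hK, ?_⟩
  intro n d M _ _ hM hκM V _ G hG r
  -- Rounding up puts the bound in `ℕ∞`, where it is checked play by play; an impossible game has
  -- infimum `⊤`.
  have key : ((⌈(8 + 5 / κ)⁻¹ * (((n : ℝ) ^ 2 * (d : ℝ) ^ 2 + (n : ℝ) * (d : ℝ) ^ 3) / (M : ℝ))⌉₊ :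
      ℕ) : ℕ∞) ≤ PebbleGame.ioComplexity r G.graph M := by
    refine le_iInf₂ fun q hq => ?_
    obtain ⟨s, hs, hout⟩ := hq
    obtain ⟨hnd, H, hHM, hroots⟩ := hG.transfer_bounds hM hs hout
    have := io_lower_bound_of_phases (n := n) (d := d) (M := M) (q := q) (H := H) hκ
      (by exact_mod_cast hM) (by positivity) (by positivity) (by positivity) (by positivity) hκM
      (by exact_mod_cast hnd) (by exact_mod_cast hHM) (by exact_mod_cast hroots)
    exact_mod_cast Nat.ceil_le.2 ((inv_mul_le_iff₀ hK).2 this)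
  refine le_trans ?_ (ENat.toENNReal_le.2 key)
  rw [ENat.toENNReal_coe, ← ENNReal.ofReal_natCast]
  exact ENNReal.ofReal_le_ofReal (Nat.le_ceil _)
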